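/- **Definitions.** For a set $A$ let $\mathcal F(A)$ be the set of finite subsets of $A$; $[x]$ denotes the integer part (floor) of $x\in\mathbb R$. For $\phi:\mathcal F(A)\to\mathbb R$ and $\beta\in\mathcal F(A)$ let $D_\beta\phi(\alpha)=\phi(\alpha\cup\beta)-\phi(\alpha)$ for $\alpha\in\mathcal F(A\setminus\beta)$. The mapping $\phi$ is *polynomial of degree $\le d$* if $D_{\beta_d}\cdots D_{\beta_0}\phi=0$ for any pairwise disjoint $\beta_0,\dots,\beta_d\in\mathcal F(A)$; $\mathrm{Pol}^0_d(A,\mathbb R)$ is the set of such mappings with $\phi(\emptyset)=0$. For $d,h,w\in\mathbb N=\{0,1,2,\dots\}$, the set $\mathrm{GPol}^0_{d,h,w}(A,\mathbb R)$ of *open constant-free generalized polynomial mappings* $\mathcal F(A)\to\mathbb R$ of degree $\le d$, height $\le h$ and width $\le w$ is defined by recursion on $h$: if $w\ge 1$, it contains $\mathrm{Pol}^0_d(A,\mathbb R)$ for every $h\ge 0$; and for $h\ge 1$ it also contains every mapping $$\phi=\sum_{j=1}^{m}[\phi_{j,1}]\cdots[\phi_{j,l_j}]\,\phi_{j,0}\qquad(m\ge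 0,\ l_j\ge 0)$$ for which there are $d_{j,t}\in\mathbb N$ with $\phi_{j,0}\in\mathrm{Pol}^0_{d_{j,0}}(A,\mathbb R)$, $\phi_{j,t}\in\mathrm{GPol}^0_{d_{j,t},h-1,w}(A,\mathbb R)$ for $1\le t\le l_j$, $\sum_{t=0}^{l_j}d_{j,t}\le d$ for every $j$, and $\sum_{j=1}^m(l_j+1)\le w$. It contains no other mappings. A *disjoint $s$-subcollection* in $A$ is a set $B$ of exactly $s$ nonempty, pairwise disjoint finite subsets of $A$. For $\phi:\mathcal F(A)\to\mathbb R$, the restriction $\phi|_B:\mathcal F(B)\to\mathbb R$ is $\phi|_B(\gamma)=\phi\bigl(\bigcup_{C\in\gamma}C\bigr)$. **Theorem.** For any $k,d_1,\dots,d_k,h,w,s\in\mathbb N$ there exists $r=r(k,(d_1,\dots,d_k),h,w,s)\in\mathbb N$ such that for any $\phi_i\in\mathrm{GPol}^0_{d_i,h,w}(\{1,\dots,r\},\mathbb R)$, $i=1,\dots,k$, there exists a disjoint $s$-subcollection $B$ in $\{1,\dots,r\}$ such that $\phi_i|_B\in\mathrm{Pol}^0_{d_i}(B,\mathbb R)$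 for all $i=1,\dots,k$. -/

import Mathlib

/-- The `β`-derivative `D_β φ (α) = φ (α ∪ β) - φ α`. It is only ever evaluated at finite sets `α`
disjoint from `β`. -/
def finsetDeriv {A H : Type*} [DecidableEq A] [AddCommGroup H]
    (β : Finset A) (φ : Finset A → H) : Finset A → H :=
  fun α => φ (α ∪ β) - φ α

/-- `φ : F(A) → H` is polynomial of degree `≤ d`: for any pairwise disjoint finite sets
`β₀, …, β_d` one has `D_{β_d} ⋯ D_{β₀} φ = 0` on the finite subsets of `A ∖ (β₀ ∪ ⋯ ∪ β_d)`. -/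
def IsPolyMap {A H : Type*} [DecidableEq A] [AddCommGroup H]
    (d : ℕ) (φ : Finset A → H) : Prop :=
  ∀ L : List (Finset A), L.length = d + 1 → L.Pairwise Disjoint →
    ∀ α : Finset A, (∀ β ∈ L, Disjoint α β) →
      L.foldl (fun ψ β => finsetDeriv β ψ) φ α = 0

/-- `φ ∈ Pol⁰_d(A, H)`: polynomial of degree `≤ d` with zero constant term. -/
def IsPolyMapZero {A H : Type*} [DecidableEq A] [AddCommGroup H]
    (d : ℕ) (φ : Finset A → H) : Prop :=
  IsPolyMap d φ ∧ φ ∅ = 0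

/-- `IsOpenGPolMap w h d φ`, that is `φ ∈ GPol⁰_{d,h,w}(A, ℝ)`: the mapping `φ : F(A) → ℝ` has a
representation as an open constant-free generalized polynomial mapping of height `≤ h`,
width `≤ w` and degree `≤ d`. Such a representation is either a conventional polynomial mapping
with zero constant term (height `0`, width `1`), or a sum
`φ = ∑_j [ψ_{j,1}] ⋯ [ψ_{j,l_j}] ψ_{j,0}`
where `ψ_{j,0}` is a conventional polynomial mapping with zero constant term, the `ψ_{j,t}`, `t ≥ 1`,
are represented in the same way with height smaller by one and width `≤ w`, the number
`∑_j (l_j + 1)` of components is `≤ w`, and the degrees in every summand add up to at most `d`. -/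
inductive IsOpenGPolMap {A : Type*} [DecidableEq A] (w : ℕ) :
    ℕ → ℕ → (Finset A → ℝ) → Prop
  | poly (h d : ℕ) (φ : Finset A → ℝ) (hw : 1 ≤ w) (hφ : IsPolyMapZero d φ) :
      IsOpenGPolMap w h d φ
  | sum (h d : ℕ) (φ : Finset A → ℝ) (m : ℕ) (l : Fin m → ℕ)
      (e₀ : Fin m → ℕ) (ψ₀ : Fin m → Finset A → ℝ)
      (e : (j : Fin m) → Fin (l j) → ℕ) (ψ : (j : Fin m) → Fin (l j) → Finset A → ℝ)
      (hψ₀ : ∀ j, IsPolyMapZero (e₀ j) (ψ₀ j))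
      (hψ : ∀ j t, IsOpenGPolMap w h (e j t) (ψ j t))
      (hwidth : ∑ j, (l j + 1) ≤ w)
      (hdeg : ∀ j, e₀ j + ∑ t, e j t ≤ d)
      (hφ : ∀ α, φ α = ∑ j, (∏ t, (⌊ψ j t α⌋ : ℝ)) * ψ₀ j α) :
      IsOpenGPolMap w (h + 1) d φ

/-- `B` is a disjoint `s`-subcollection in `A`: a set of `s` nonempty, pairwise disjoint finite
subsets of `A`. -/
def IsDisjointSubcollection {A : Type*} (s : ℕ) (B : Finset (Finset A)) : Prop :=
  B.card = s ∧ (∀ b ∈ B, b.Nonempty) ∧ (B : Set (Finset A)).Pairwise Disjoint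

/-- The restriction of `φ : F(A) → H` to `F(B)`, where `γ ∈ F(B)` is identified with
`⋃ γ ∈ F(A)`. -/
def restrictSubcollection {A H : Type*} [DecidableEq A] (B : Finset (Finset A))
    (φ : Finset A → H) : Finset B → H :=
  fun γ => φ (γ.biUnion fun b => (b : Finset A))

/-! By induction on height, the bracketed components become conventional polynomial mappings `ψ`
with `ψ ∅ = 0` after restriction, so the issue is the integer part of such a `ψ`. Colour sets by the
approximate fractional parts of all components. The finite unions theorem, obtained from
Hales–Jewett and pigeonhole, makes each fractional part nearly a constant `y` on nonempty unions.

Iterated differences at `∅` then force `-y` to be close to an integer `m`. So `ψ + m` is close to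
the integer-valued mapping equal to `⌊ψ⌋` off `∅` and to `m` at `∅`. High derivatives of that
mapping are integers of absolute value less than 1, hence zero
(`IsPolyMapZero.exists_isPolyMap_eq_floor`). The altered value at `∅` is harmless: every product has
an unbracketed factor vanishing there (`isPolyMapZero_sum_prod_floor`). -/

/-! ### Disjoint families -/

/-- A family of nonempty, pairwise disjoint finite sets. -/
def IsDisjointFamily {ι A : Type*} (b : ι → Finset A) : Prop :=
  (∀ i, (b i).Nonempty) ∧ Pairwise fun i j => Disjoint (b i) (b j)

theorem IsDisjointFamily.disjoint_biUnion {ι A : Type*} [DecidableEq A]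
    {b : ι → Finset A} (hb : IsDisjointFamily b) {s t : Finset ι} (hst : Disjoint s t) :
    Disjoint (s.biUnion b) (t.biUnion b) := by
  rw [Finset.disjoint_biUnion_left]
  intro i hi
  rw [Finset.disjoint_biUnion_right]
  intro j hj
  exact hb.2 (fun h => Finset.disjoint_left.1 hst hi (h ▸ hj))

theorem IsDisjointFamily.biUnion {ι κ A : Type*} [DecidableEq A] {b : ι → Finset A}
    (hb : IsDisjointFamily b) {c : κ → Finset ι} (hc : IsDisjointFamily c) :
    IsDisjointFamily fun k => (c k).biUnion b := by
  refine ⟨fun k => ?_, fun k l hkl => hb.disjoint_biUnion (hc.2 hkl)⟩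
  obtain ⟨i, hi⟩ := hc.1 k
  obtain ⟨a, ha⟩ := hb.1 i
  exact ⟨a, Finset.mem_biUnion.2 ⟨i, hi, ha⟩⟩

theorem IsDisjointFamily.comp {ι κ A : Type*} {b : ι → Finset A}
    (hb : IsDisjointFamily b) {f : κ → ι} (hf : Function.Injective f) :
    IsDisjointFamily (b ∘ f) :=
  ⟨fun k => hb.1 (f k), fun _ _ hkl => hb.2 (hf.ne hkl)⟩

theorem isDisjointFamily_singleton {ι A : Type*} {f : ι → A} (hf : Function.Injective f) :
    IsDisjointFamily fun i => ({f i} : Finset A) :=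
  ⟨fun i => Finset.singleton_nonempty _, fun _ _ hij => by simpa using hf.ne hij⟩

/-- The `γ` lying above `0` in `Fin (n + 1)` come from `Fin n`. -/
theorem Fin.exists_finset_eq_map_succEmb {n : ℕ} {γ : Finset (Fin (n + 1))}
    (h : ∀ j ∈ γ, 0 < j) : ∃ γ' : Finset (Fin n), γ = γ'.map (Fin.succEmb n) := by
  refine ⟨Finset.univ.filter fun j => j.succ ∈ γ, ?_⟩
  ext j
  cases j using Fin.cases with
  | zero =>
    have : (0 : Fin (n + 1)) ∉ γ := fun h0 => lt_irrefl _ (h 0 h0)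
    simp [this]
  | succ j => simp

/-! ### The finite unions theorem -/

/-- In a finite colouring of the subsets of a large set there is a disjoint family of given size
such that the colour of a union depends only on the smallest index that occurs in it. -/
theorem exists_disjointFamily_color_eq_of_min (κ : Type*) [Finite κ] (n : ℕ) :
    ∃ N : ℕ, ∀ C : Finset (Fin N) → κ, ∃ b : Fin n → Finset (Fin N), IsDisjointFamily b ∧
      ∃ c : Fin n → κ, ∀ i, ∀ γ : Finset (Fin n), (∀ j ∈ γ, i < j) →
        C (b i ∪ γ.biUnion b) = c i := by
  induction n with
  | zero => exact ⟨0, fun C => ⟨Fin.elim0, ⟨fun i => i.elim0, fun i => i.elim0⟩,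
      Fin.elim0, fun i => i.elim0⟩⟩
  | succ n ih =>
    obtain ⟨N, hN⟩ := ih
    -- Words over `Bool` encode subsets. The direction `none` is kept switched on, which makes `b₀`
    -- nonempty; the other `N` directions feed the induction.
    obtain ⟨M, hM⟩ := Combinatorics.Subspace.exists_mono_in_high_dimension_fin
      Bool κ (Option (Fin N))
    refine ⟨M, fun C => ?_⟩
    obtain ⟨l, c₀, hl⟩ := hM fun x => C (Finset.univ.filter fun i => x i = true)
    set b₀ : Finset (Fin M) :=
      Finset.univ.filter fun i => l.idxFun i = Sum.inl true ∨ l.idxFun i = Sum.inr none with hb₀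
    set v : Fin N → Finset (Fin M) := fun j =>
      Finset.univ.filter fun i => l.idxFun i = Sum.inr (some j) with hv
    have hcol : ∀ γ : Finset (Fin N), C (b₀ ∪ γ.biUnion v) = c₀ := by
      intro γ
      rw [← hl fun o => o.elim true fun j => decide (j ∈ γ)]
      congr 1
      ext i
      rw [Finset.mem_filter, Combinatorics.Subspace.apply_def]
      rcases hi : l.idxFun i with a | (_ | j) <;> simp [hb₀, hv, hi]
    have hvf : IsDisjointFamily v := by
      refine ⟨fun j => ?_, fun j j' hjj => ?_⟩
      · obtain ⟨i, hi⟩ := l.proper (some j)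
        exact ⟨i, by simp [hv, hi]⟩
      · refine Finset.disjoint_left.2 fun i hi hi' => ?_
        simp only [hv, Finset.mem_filter, Finset.mem_univ, true_and] at hi hi'
        rw [hi] at hi'
        exact hjj (by simpa using hi')
    have hb₀n : b₀.Nonempty := by
      obtain ⟨i, hi⟩ := l.proper none
      exact ⟨i, by simp [hb₀, hi]⟩
    have hb₀v : ∀ j, Disjoint b₀ (v j) := by
      intro j
      rw [Finset.disjoint_left]
      intro i hi hi'
      simp only [hb₀, hv, Finset.mem_filter, Finset.mem_univ, true_and] at hi hi'
      rw [hi'] at hi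
      simp at hi
    obtain ⟨b, hb, c, hc⟩ := hN fun γ => C (γ.biUnion v)
    have hbv := hvf.biUnion hb
    have hb₀b : ∀ j, Disjoint b₀ ((b j).biUnion v) := fun j => by
      rw [Finset.disjoint_biUnion_right]
      exact fun i _ => hb₀v i
    have hmap : ∀ γ : Finset (Fin n), (γ.map (Fin.succEmb n)).biUnion
        (Fin.cons b₀ fun j => (b j).biUnion v : Fin (n + 1) → Finset (Fin M)) =
          (γ.biUnion b).biUnion v := by
      intro γ
      rw [Finset.map_eq_image, Finset.image_biUnion, Finset.biUnion_biUnion]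
      simp
    refine ⟨Fin.cons b₀ fun j => (b j).biUnion v, ⟨fun i => ?_, fun i j hij => ?_⟩,
      Fin.cons c₀ c, fun i γ hγ => ?_⟩
    · cases i using Fin.cases with
      | zero => simpa using hb₀n
      | succ i => simpa using hbv.1 i
    · cases i using Fin.cases with
      | zero =>
        cases j using Fin.cases with
        | zero => exact absurd rfl hij
        | succ j => simpa using hb₀b j
      | succ i =>
        cases j using Fin.cases with
        | zero => simpa using (hb₀b i).symm
        | succ j => simpa using hbv.2 (fun h : i = j => hij (congrArg Fin.succ h))
    · obtain ⟨γ', rfl⟩ := Fin.exists_finset_eq_map_succEmb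
        fun j hj => (Fin.zero_le i).trans_lt (hγ j hj)
      rw [hmap]
      cases i using Fin.cases with
      | zero => simpa using hcol _
      | succ i =>
        have := hc i γ' fun j hj => by simpa using hγ j.succ (by simpa using hj)
        simpa [Finset.union_biUnion] using this

/-- The **finite unions theorem** (Folkman, Rado, Sanders). -/
theorem exists_disjointFamily_monochromatic (κ : Type*) [Finite κ] (s : ℕ) :
    ∃ N : ℕ, ∀ C : Finset (Fin N) → κ, ∃ b : Fin s → Finset (Fin N), IsDisjointFamily b ∧
      ∃ c : κ, ∀ γ : Finset (Fin s), γ.Nonempty → C (γ.biUnion b) = c := by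
  classical
  have := Fintype.ofFinite κ
  -- With this many indices, pigeonhole gives more than `s` of them the same colour.
  obtain ⟨N, hN⟩ := exists_disjointFamily_color_eq_of_min κ (Fintype.card κ * s + 1)
  refine ⟨N, fun C => ?_⟩
  obtain ⟨b, hb, c, hc⟩ := hN C
  obtain ⟨y, hy⟩ := Fintype.exists_lt_card_fiber_of_mul_lt_card (n := s) c (by simp)
  obtain ⟨f⟩ : Nonempty (Fin s ↪ {i // c i = y}) := by
    apply Function.Embedding.nonempty_of_card_le
    rw [Fintype.card_fin, Fintype.card_subtype]
    exact hy.le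
  refine ⟨fun i => b (f i), hb.comp (Subtype.val_injective.comp f.injective), y, fun γ hγ => ?_⟩
  obtain ⟨i, hi, hmin⟩ := Finset.exists_min_image γ (fun i => (f i).1) hγ
  have key := hc (f i) ((γ.erase i).image fun j => (f j).1) (by
    intro j hj
    obtain ⟨k, hk, rfl⟩ := Finset.mem_image.1 hj
    refine lt_of_le_of_ne (hmin k (Finset.mem_of_mem_erase hk)) fun h => ?_
    exact Finset.ne_of_mem_erase hk (f.injective (Subtype.ext h)).symm)
  rw [(f i).2, Finset.image_biUnion] at key
  rwa [← Finset.biUnion_insert (s := γ.erase i) (t := fun i => b (f i)),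
    Finset.insert_erase hi] at key

/-! ### Calculus of polynomial mappings -/

/-- `f` is a polynomial mapping of degree `< n` on the finite sets disjoint from `X`. -/
def PolyAway {A H : Type*} [DecidableEq A] [AddCommGroup H] :
    ℕ → Finset A → (Finset A → H) → Prop
  | 0, X, f => ∀ α, Disjoint α X → f α = 0
  | n + 1, X, f => ∀ β, Disjoint β X → PolyAway n (X ∪ β) (finsetDeriv β f)

section PolyAway

variable {A A' H : Type*} [DecidableEq A] [DecidableEq A'] [AddCommGroup H]

/-- Enlarging `X` by each direction used encodes pairwise disjointness one derivative at a time, so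
later proofs can induct on `n` without lists. -/
theorem polyAway_iff_foldl (n : ℕ) (X : Finset A) (f : Finset A → H) :
    PolyAway n X f ↔ ∀ L : List (Finset A), L.length = n → L.Pairwise Disjoint →
      (∀ β ∈ L, Disjoint β X) → ∀ α : Finset A, Disjoint α X → (∀ β ∈ L, Disjoint α β) →
        L.foldl (fun ψ β => finsetDeriv β ψ) f α = 0 := by
  induction n generalizing X f with
  | zero => simp [PolyAway]
  | succ n ih =>
    simp only [PolyAway, ih]
    constructor
    · intro h L hL hp hX α hα hαL
      obtain _ | ⟨β, L⟩ := L
      · simp at hL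
      rw [List.pairwise_cons] at hp
      simp only [List.forall_mem_cons] at hX hαL
      refine h β hX.1 L (by simpa using hL) hp.2 (fun γ hγ => ?_) α ?_ hαL.2
      · exact Finset.disjoint_union_right.2 ⟨hX.2 γ hγ, (hp.1 γ hγ).symm⟩
      · exact Finset.disjoint_union_right.2 ⟨hα, hαL.1⟩
    · intro h β hβ L hL hp hX α hα hαL
      simp only [Finset.disjoint_union_right] at hX hα
      exact h (β :: L) (by simpa using hL)
        (List.pairwise_cons.2 ⟨fun γ hγ => (hX γ hγ).2.symm, hp⟩)
        (by simpa using ⟨hβ, fun γ hγ => (hX γ hγ).1⟩) α hα.1 (by simpa using ⟨hα.2, hαL⟩)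

theorem isPolyMap_iff_polyAway (d : ℕ) (f : Finset A → H) :
    IsPolyMap d f ↔ PolyAway (d + 1) ∅ f := by
  rw [polyAway_iff_foldl]
  simp [IsPolyMap]

theorem finsetDeriv_add (β : Finset A) (f g : Finset A → H) :
    finsetDeriv β (f + g) = finsetDeriv β f + finsetDeriv β g := by
  ext α
  simp only [finsetDeriv, Pi.add_apply]
  abel

theorem PolyAway.add {n : ℕ} {X : Finset A} {f g : Finset A → H}
    (hf : PolyAway n X f) (hg : PolyAway n X g) : PolyAway n X (f + g) := by
  induction n generalizing X f g with
  | zero => intro α hα; simp [hf α hα, hg α hα]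
  | succ n ih =>
    intro β hβ
    rw [finsetDeriv_add]
    exact ih (hf β hβ) (hg β hβ)

theorem PolyAway.of_eq_zero {n : ℕ} {X : Finset A} {f : Finset A → H}
    (hf : ∀ α, Disjoint α X → f α = 0) : PolyAway n X f := by
  induction n generalizing X f with
  | zero => exact hf
  | succ n ih =>
    intro β hβ
    refine ih fun α hα => ?_
    rw [Finset.disjoint_union_right] at hα
    simp [finsetDeriv, hf α hα.1, hf (α ∪ β) (Finset.disjoint_union_left.2 ⟨hα.1, hβ⟩)]

theorem PolyAway.succ {n : ℕ} {X : Finset A} {f : Finset A → H}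
    (hf : PolyAway n X f) : PolyAway (n + 1) X f := by
  induction n generalizing X f with
  | zero => exact PolyAway.of_eq_zero hf
  | succ n ih => exact fun β hβ => ih (hf β hβ)

theorem PolyAway.mono {m n : ℕ} (hmn : m ≤ n) {X : Finset A} {f : Finset A → H}
    (hf : PolyAway m X f) : PolyAway n X f := by
  induction n, hmn using Nat.le_induction with
  | base => exact hf
  | succ n _ ih => exact ih.succ

theorem polyAway_const (n : ℕ) (X : Finset A) (c : H) :
    PolyAway (n + 1) X fun _ => c :=
  fun β _ => PolyAway.of_eq_zero fun α _ => by simp [finsetDeriv]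

theorem finsetDeriv_mul {R : Type*} [CommRing R] (β : Finset A) (f g : Finset A → R) :
    finsetDeriv β (f * g) =
      (finsetDeriv β f * g + f * finsetDeriv β g) + finsetDeriv β f * finsetDeriv β g := by
  ext α
  simp only [finsetDeriv, Pi.add_apply, Pi.mul_apply]
  ring

theorem PolyAway.anti {n : ℕ} {X Y : Finset A} (hXY : X ⊆ Y) {f : Finset A → H}
    (hf : PolyAway n X f) : PolyAway n Y f := by
  induction n generalizing X Y f with
  | zero => exact fun α hα => hf α (Finset.disjoint_of_subset_right hXY hα)
  | succ n ih =>
    exact fun β hβ => ih (Finset.union_subset_union_left hXY)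
      (hf β (Finset.disjoint_of_subset_right hXY hβ))

/-- The product of polynomial mappings of degree `< m` and `< n` has degree `< m + n - 1`. -/
theorem PolyAway.mul {R : Type*} [CommRing R] {m n k : ℕ} (hk : m + n ≤ k + 1) {X : Finset A}
    {f g : Finset A → R} (hf : PolyAway m X f) (hg : PolyAway n X g) :
    PolyAway k X (f * g) := by
  induction k generalizing m n X f g with
  | zero =>
    obtain rfl | rfl : m = 0 ∨ n = 0 := by omega
    · exact PolyAway.of_eq_zero fun α hα => by simp [hf α hα]
    · exact PolyAway.of_eq_zero fun α hα => by simp [hg α hα]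
  | succ k ih =>
    obtain _ | m := m
    · exact PolyAway.of_eq_zero fun α hα => by simp [hf α hα]
    obtain _ | n := n
    · exact PolyAway.of_eq_zero fun α hα => by simp [hg α hα]
    intro β hβ
    rw [finsetDeriv_mul]
    have hf' := hf.anti (Finset.subset_union_left (s₂ := β))
    have hg' := hg.anti (Finset.subset_union_left (s₂ := β))
    -- In each term of the product rule at least one factor has been differentiated, so the total
    -- degree drops.
    exact ((ih (by omega) (hf β hβ) hg').add (ih (by omega) hf' (hg β hβ))).add
      (ih (by omega) (hf β hβ) (hg β hβ))

theorem PolyAway.comp {n : ℕ} {X : Finset A'} {f : Finset A → H} {g : Finset A' → Finset A}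
    (hunion : ∀ α β, g (α ∪ β) = g α ∪ g β)
    (hdisj : ∀ α β, Disjoint α β → Disjoint (g α) (g β))
    (hf : PolyAway n (g X) f) : PolyAway n X (f ∘ g) := by
  induction n generalizing X f with
  | zero => exact fun α hα => hf _ (hdisj _ _ hα)
  | succ n ih =>
    intro β hβ
    have h : finsetDeriv β (f ∘ g) = finsetDeriv (g β) f ∘ g := by
      ext α
      simp [finsetDeriv, hunion]
    rw [h]
    apply ih
    rw [hunion]
    exact hf _ (hdisj _ _ hβ)

end PolyAway

section IsPolyMap

variable {A A' H : Type*} [DecidableEq A] [DecidableEq A'] [AddCommGroup H]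

theorem IsPolyMap.mono {m n : ℕ} (hmn : m ≤ n) {f : Finset A → H}
    (hf : IsPolyMap m f) : IsPolyMap n f := by
  rw [isPolyMap_iff_polyAway] at *
  exact hf.mono (by omega)

theorem isPolyMap_const (n : ℕ) (c : H) : IsPolyMap n fun _ : Finset A => c :=
  (isPolyMap_iff_polyAway _ _).2 (polyAway_const n _ c)

theorem IsPolyMap.mul {R : Type*} [CommRing R] {m n : ℕ} {f g : Finset A → R}
    (hf : IsPolyMap m f) (hg : IsPolyMap n g) : IsPolyMap (m + n) (f * g) := by
  rw [isPolyMap_iff_polyAway] at *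
  exact hf.mul (by omega) hg

theorem IsPolyMap.sum {ι : Type*} (s : Finset ι) {n : ℕ} {f : ι → Finset A → H}
    (hf : ∀ i ∈ s, IsPolyMap n (f i)) : IsPolyMap n fun α => ∑ i ∈ s, f i α := by
  classical
  induction s using Finset.induction_on with
  | empty => simpa using isPolyMap_const n (0 : H)
  | insert i s hi ih =>
    simp only [Finset.sum_insert hi]
    have h₁ := hf i (Finset.mem_insert_self i s)
    have h₂ := ih fun j hj => hf j (Finset.mem_insert_of_mem hj)
    rw [isPolyMap_iff_polyAway] at *
    exact h₁.add h₂

theorem IsPolyMap.prod {ι R : Type*} [CommRing R] (s : Finset ι) {n : ι → ℕ}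
    {f : ι → Finset A → R} (hf : ∀ i ∈ s, IsPolyMap (n i) (f i)) :
    IsPolyMap (∑ i ∈ s, n i) fun α => ∏ i ∈ s, f i α := by
  classical
  induction s using Finset.induction_on with
  | empty => simpa using isPolyMap_const 0 (1 : R)
  | insert i s hi ih =>
    simp only [Finset.prod_insert hi, Finset.sum_insert hi]
    exact (hf i (Finset.mem_insert_self i s)).mul
      (ih fun j hj => hf j (Finset.mem_insert_of_mem hj))

theorem IsPolyMap.comp_biUnion {ι : Type*} [DecidableEq ι] {n : ℕ} {f : Finset A → H}
    (hf : IsPolyMap n f) {b : ι → Finset A} (hb : IsDisjointFamily b) :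
    IsPolyMap n fun γ : Finset ι => f (γ.biUnion b) := by
  rw [isPolyMap_iff_polyAway] at *
  exact PolyAway.comp (g := fun γ : Finset ι => γ.biUnion b)
    (fun α β => Finset.union_biUnion) (fun α β h => hb.disjoint_biUnion h) (by simpa using hf)

theorem IsPolyMapZero.comp_biUnion {ι : Type*} [DecidableEq ι] {n : ℕ} {f : Finset A → H}
    (hf : IsPolyMapZero n f) {b : ι → Finset A} (hb : IsDisjointFamily b) :
    IsPolyMapZero n fun γ : Finset ι => f (γ.biUnion b) :=
  ⟨hf.1.comp_biUnion hb, by simpa using hf.2⟩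

end IsPolyMap

/-! ### Integer parts of polynomial mappings -/

section Floor

variable {A : Type*} [DecidableEq A]

/-- An integer-valued mapping close to a polynomial mapping is polynomial of the same degree. -/
theorem PolyAway.of_int_close {n : ℕ} {X : Finset A} {ψ : Finset A → ℝ} (hψ : PolyAway n X ψ)
    {G : Finset A → ℤ} {η : ℝ} (hη : 2 ^ n * η < 1)
    (hG : ∀ α, Disjoint α X → |ψ α - G α| ≤ η) : PolyAway n X fun α => (G α : ℝ) := by
  induction n generalizing X ψ G η with
  | zero =>
    intro α hα
    have h := hG α hα
    rw [hψ α hα, zero_sub, abs_neg] at h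
    have h1 : |(G α : ℝ)| < 1 := by linarith
    have : |G α| < 1 := by exact_mod_cast h1
    simpa using Int.abs_lt_one_iff.1 this
  | succ n ih =>
    intro β hβ
    -- A derivative at most doubles the error, so `2 ^ n * η` is preserved.
    have h := ih (hψ β hβ) (G := finsetDeriv β G) (η := 2 * η) (by rw [pow_succ] at hη; linarith)
      fun α hα => by
        rw [Finset.disjoint_union_right] at hα
        have h₁ := abs_le.1 (hG α hα.1)
        have h₂ := abs_le.1 (hG (α ∪ β) (Finset.disjoint_union_left.2 ⟨hα.1, hβ⟩))
        simp only [finsetDeriv, Int.cast_sub]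
        rw [abs_le]
        constructor <;> linarith
    convert h using 1
    ext α
    simp [finsetDeriv]

/-- If a polynomial mapping is close to an integer-valued mapping, up to an error `x` at `∅`,
then `x` is close to an integer. -/
theorem PolyAway.exists_int_close_of_error_empty [Fintype A] {n : ℕ} {X : Finset A}
    {ψ : Finset A → ℝ} (hψ : PolyAway n X ψ) (hX : X.card + n ≤ Fintype.card A)
    {G : Finset A → ℤ} {η x : ℝ}
    (hG : ∀ α, Disjoint α X → |ψ α - G α - (if α = ∅ then x else 0)| ≤ η) :
    ∃ m : ℤ, |x - m| ≤ 2 ^ n * η := by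
  induction n generalizing X ψ G η x with
  | zero =>
    refine ⟨-G ∅, ?_⟩
    have h := hG ∅ (Finset.disjoint_empty_left X)
    rw [hψ ∅ (Finset.disjoint_empty_left X), if_pos rfl, ← abs_neg] at h
    convert h using 2
    · push_cast; ring
    · ring
  | succ n ih =>
    obtain ⟨a, ha⟩ : ∃ a, a ∉ X := by
      by_contra! h
      rw [Finset.eq_univ_iff_forall.2 h, Finset.card_univ] at hX
      omega
    have haX : Disjoint {a} X := Finset.disjoint_singleton_left.2 ha
    -- As `α ∪ {a}` is never empty, the exceptional error survives only in the subtracted term, so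
    -- `x` becomes `-x`.
    obtain ⟨m, hm⟩ := ih (hψ {a} haX) (G := finsetDeriv {a} G) (η := 2 * η) (x := -x)
      (by
        have := Finset.card_union_le X {a}
        rw [Finset.card_singleton] at this
        omega)
      fun α hα => by
        rw [Finset.disjoint_union_right] at hα
        have h₁ := abs_le.1 (hG α hα.1)
        have h₂ := abs_le.1 (hG (α ∪ {a}) (Finset.disjoint_union_left.2 ⟨hα.1, haX⟩))
        rw [if_neg (Finset.Nonempty.ne_empty ⟨a, by simp⟩)] at h₂
        simp only [finsetDeriv, Int.cast_sub]
        rw [abs_le]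
        split_ifs at * <;> constructor <;> linarith
    refine ⟨-m, ?_⟩
    rw [← abs_neg]
    convert hm using 1
    · congr 1; push_cast; ring
    · ring

/-- If the fractional parts of a polynomial mapping with zero constant term are almost constant
on nonempty sets, then its integer part is polynomial there. -/
theorem IsPolyMapZero.exists_isPolyMap_eq_floor [Fintype A] {d : ℕ} {ψ : Finset A → ℝ}
    (hψ : IsPolyMapZero d ψ) (hd : d + 1 ≤ Fintype.card A) {y η : ℝ} (hη₀ : 0 ≤ η)
    (hη : 2 ^ (d + 1) * ((2 ^ (d + 1) + 1) * η) < 1)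
    (hy : ∀ α : Finset A, α.Nonempty → |Int.fract (ψ α) - y| ≤ η) :
    ∃ Q : Finset A → ℝ, IsPolyMap d Q ∧ ∀ α : Finset A, α.Nonempty → (⌊ψ α⌋ : ℝ) = Q α := by
  have hsub : ∀ c : ℝ, PolyAway (d + 1) ∅ fun α => ψ α - c := fun c => by
    have h := ((isPolyMap_iff_polyAway _ _).1 hψ.1).add (polyAway_const d ∅ (-c))
    simp only [sub_eq_add_neg]
    exact h
  -- Off `∅`, `ψ - y - ⌊ψ⌋` is small; at `∅` the error is exactly `-y`.
  obtain ⟨m, hm⟩ := (hsub y).exists_int_close_of_error_empty (by simpa using hd)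
    (G := fun α => if α = ∅ then 0 else ⌊ψ α⌋) (η := η) (x := -y) fun α _ => by
      by_cases hα : α = ∅
      · subst hα
        simpa [hψ.2] using hη₀
      · have h := hy α (Finset.nonempty_iff_ne_empty.2 hα)
        rw [Int.fract] at h
        simp only [hα, if_false, sub_zero]
        rwa [sub_right_comm]
  refine ⟨fun α => ((if α = ∅ then m else ⌊ψ α⌋ : ℤ) : ℝ), ?_, fun α hα => ?_⟩
  · rw [isPolyMap_iff_polyAway]
    -- The error is `0` at `∅`. Elsewhere it is `fract ψ + m = (fract ψ - y) + (y + m)`, which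
    -- explains the factor `2 ^ (d + 1) + 1`.
    refine (hsub (-m)).of_int_close hη fun α _ => ?_
    by_cases hα : α = ∅
    · subst hα
      simp only [hψ.2, if_true]
      simpa using by positivity
    · have h := abs_le.1 (hy α (Finset.nonempty_iff_ne_empty.2 hα))
      have hm' := abs_le.1 hm
      rw [Int.fract] at h
      simp only [hα, if_false]
      rw [abs_le]
      constructor <;> linarith
  · simp [hα.ne_empty]

/-- Finitely many polynomial mappings with zero constant term can be restricted to a disjoint
family so that the integer parts become polynomial on nonempty sets. -/
theorem exists_disjointFamily_floor_isPolyMap (N D s : ℕ) :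
    ∃ r : ℕ, ∀ (ι : Type) [Fintype ι], Fintype.card ι ≤ N → ∀ d : ι → ℕ, (∀ i, d i ≤ D) →
      ∀ φ : ι → Finset (Fin r) → ℝ, (∀ i, IsPolyMapZero (d i) (φ i)) →
        ∃ b : Fin s → Finset (Fin r), IsDisjointFamily b ∧
          ∀ i, ∃ Q : Finset (Fin s) → ℝ, IsPolyMap (d i) Q ∧
            ∀ γ : Finset (Fin s), γ.Nonempty → (⌊φ i (γ.biUnion b)⌋ : ℝ) = Q γ := by
  -- The closeness condition with `η = 1 / M` holds because `2 ^ (D + 1) * (2 ^ (D + 1) + 1) < 4 ^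
  -- (D + 2)`.
  set M : ℕ := 4 ^ (D + 2) with hM
  have hM0 : 0 < M := by positivity
  have hMR : (0 : ℝ) < M := by exact_mod_cast hM0
  have : NeZero M := ⟨hM0.ne'⟩
  -- At least `D + 1` blocks are needed to take enough differences; the surplus over `s` is
  -- discarded at the end. The palette depends on `N`, not on `ι`, so `r` is uniform.
  obtain ⟨r, hr⟩ := exists_disjointFamily_monochromatic (Fin N → Fin M) (max s (D + 1))
  refine ⟨r, fun ι _ hι d hd φ hφ => ?_⟩
  obtain ⟨f⟩ : Nonempty (ι ↪ Fin N) :=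
    Function.Embedding.nonempty_of_card_le (by simpa using hι)
  have hlt : ∀ x : ℝ, ⌊M * Int.fract x⌋₊ < M := fun x => by
    rw [Nat.floor_lt (by have := Int.fract_nonneg x; positivity)]
    exact mul_lt_of_lt_one_right hMR (Int.fract_lt_one x)
  obtain ⟨b, hb, c, hc⟩ := hr fun α =>
    Function.extend f (fun i => (⟨⌊M * Int.fract (φ i α)⌋₊, hlt _⟩ : Fin M)) fun _ => 0
  have hinj := Fin.castLE_injective (le_max_left s (D + 1))
  refine ⟨fun i => b (Fin.castLE (le_max_left s (D + 1)) i), hb.comp hinj, fun i => ?_⟩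
  obtain ⟨Q, hQ, hfl⟩ := ((hφ i).comp_biUnion hb).exists_isPolyMap_eq_floor
    (by simpa using Or.inr (hd i)) (y := (c (f i) : ℕ) / M) (η := 1 / M) (by positivity)
    (by
      have h1 : (2 : ℝ) ^ (d i + 1) ≤ 2 ^ (D + 1) := pow_le_pow_right₀ (by norm_num) (by
        have := hd i; omega)
      have h2 : (1 : ℝ) ≤ 2 ^ (D + 1) := one_le_pow₀ (by norm_num)
      have h3 : (M : ℝ) = 4 * (2 ^ (D + 1) * 2 ^ (D + 1)) := by
        rw [hM]
        push_cast
        rw [← mul_pow]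
        norm_num [pow_succ]
        ring
      have h4 : (0 : ℝ) < 2 ^ (d i + 1) := by positivity
      rw [← mul_assoc, mul_one_div, div_lt_one hMR, h3]
      nlinarith)
    (fun α hα => by
      have h := congrArg Fin.val (congrFun (hc α hα) (f i))
      rw [f.injective.extend_apply] at h
      have h0 : 0 ≤ M * Int.fract (φ i (α.biUnion b)) := by
        have := Int.fract_nonneg (φ i (α.biUnion b)); positivity
      have h1 := Nat.floor_le h0
      have h2 := Nat.lt_floor_add_one (M * Int.fract (φ i (α.biUnion b)))
      simp only at h
      rw [h] at h1 h2
      have h3 : Int.fract (φ i (α.biUnion b)) - (c (f i) : ℕ) / M =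
          (M * Int.fract (φ i (α.biUnion b)) - (c (f i) : ℕ)) / M := by
        field_simp
      rw [h3, abs_div, abs_of_pos hMR]
      gcongr
      rw [abs_le]
      constructor <;> linarith)
  refine ⟨_, hQ.comp_biUnion (isDisjointFamily_singleton hinj), fun γ hγ => ?_⟩
  rw [← hfl _ (by
    obtain ⟨a, ha⟩ := hγ
    exact ⟨Fin.castLE (le_max_left s (D + 1)) a, Finset.mem_biUnion.2 ⟨a, ha, by simp⟩⟩), Finset.biUnion_biUnion]
  simp

end Floor

/-! ### Generalized polynomial mappings and the induction on height -/

/-- Every open generalized polynomial mapping of height `≤ h + 1` is a sum of products. -/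
theorem IsOpenGPolMap.exists_sum {A : Type*} [DecidableEq A] {w h d : ℕ} {φ : Finset A → ℝ}
    (hφ : IsOpenGPolMap w (h + 1) d φ) :
    ∃ (m : ℕ) (l : Fin m → ℕ) (e₀ : Fin m → ℕ) (ψ₀ : Fin m → Finset A → ℝ)
      (e : (j : Fin m) → Fin (l j) → ℕ) (ψ : (j : Fin m) → Fin (l j) → Finset A → ℝ),
      (∀ j, IsPolyMapZero (e₀ j) (ψ₀ j)) ∧ (∀ j t, IsOpenGPolMap w h (e j t) (ψ j t)) ∧
      ∑ j, (l j + 1) ≤ w ∧ (∀ j, e₀ j + ∑ t, e j t ≤ d) ∧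
      ∀ α, φ α = ∑ j, (∏ t, (⌊ψ j t α⌋ : ℝ)) * ψ₀ j α := by
  cases hφ with
  | poly _ _ _ hw hφ =>
    exact ⟨1, fun _ => 0, fun _ => d, fun _ => φ, fun _ t => t.elim0, fun _ t => t.elim0,
      fun _ => hφ, fun _ t => t.elim0, by simpa using hw, by simp, by simp⟩
  | sum _ _ _ m l e₀ ψ₀ e ψ hψ₀ hψ hwidth hdeg hφ =>
    exact ⟨m, l, e₀, ψ₀, e, ψ, hψ₀, hψ, hwidth, hdeg, hφ⟩

theorem IsOpenGPolMap.isPolyMapZero {A : Type*} [DecidableEq A] {w d : ℕ} {φ : Finset A → ℝ}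
    (hφ : IsOpenGPolMap w 0 d φ) : IsPolyMapZero d φ := by
  cases hφ with
  | poly _ _ _ _ hφ => exact hφ

/-- If the bracketed components agree with polynomial mappings on nonempty sets, a sum of products
with constant-free last factors is polynomial. -/
theorem isPolyMapZero_sum_prod_floor {A : Type*} [DecidableEq A] {d m : ℕ} {l : Fin m → ℕ}
    {e₀ : Fin m → ℕ} {ψ₀ : Fin m → Finset A → ℝ} {e : (j : Fin m) → Fin (l j) → ℕ}
    {g Q : (j : Fin m) → Fin (l j) → Finset A → ℝ}
    (hψ₀ : ∀ j, IsPolyMapZero (e₀ j) (ψ₀ j)) (hQ : ∀ j t, IsPolyMap (e j t) (Q j t))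
    (hdeg : ∀ j, e₀ j + ∑ t, e j t ≤ d)
    (hgQ : ∀ j t, ∀ α : Finset A, α.Nonempty → g j t α = Q j t α) :
    IsPolyMapZero d fun α => ∑ j, (∏ t, g j t α) * ψ₀ j α := by
  have h : (fun α => ∑ j, (∏ t, g j t α) * ψ₀ j α) =
      fun α => ∑ j, (∏ t, Q j t α) * ψ₀ j α := by
    ext α
    refine Finset.sum_congr rfl fun j _ => ?_
    -- At `∅` the factors `g` and `Q` may differ, but `ψ₀` kills both products.
    rcases α.eq_empty_or_nonempty with rfl | hα
    · simp [(hψ₀ j).2]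
    · simp only [hgQ j _ α hα]
  refine ⟨?_, by simp [(hψ₀ _).2]⟩
  rw [h]
  refine IsPolyMap.sum _ fun j _ => ?_
  refine IsPolyMap.mono (hdeg j) ?_
  rw [add_comm]
  exact (IsPolyMap.prod Finset.univ fun t _ => hQ j t).mul (hψ₀ j).1

/-- Finitely many open generalized polynomial mappings can be restricted to a disjoint family on
which they are polynomial. -/
theorem exists_disjointFamily_isPolyMapZero (h w N D s : ℕ) :
    ∃ r : ℕ, ∀ (ι : Type) [Fintype ι], Fintype.card ι ≤ N → ∀ d : ι → ℕ, (∀ i, d i ≤ D) →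
      ∀ φ : ι → Finset (Fin r) → ℝ, (∀ i, IsOpenGPolMap w h (d i) (φ i)) →
        ∃ b : Fin s → Finset (Fin r), IsDisjointFamily b ∧
          ∀ i, IsPolyMapZero (d i) fun γ : Finset (Fin s) => φ i (γ.biUnion b) := by
  induction h generalizing N s with
  | zero =>
    refine ⟨s, fun ι _ _ d _ φ hφ => ⟨_, isDisjointFamily_singleton Function.injective_id,
      fun i => ?_⟩⟩
    simpa using (hφ i).isPolyMapZero
  | succ h ih =>
    -- Sizes are chosen backwards: the induction hypothesis must leave `r₁` blocks for the floor
    -- step. At most `N * w` bracketed components occur in all.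
    obtain ⟨r₁, hr₁⟩ := exists_disjointFamily_floor_isPolyMap (N * w) D s
    obtain ⟨r, hr⟩ := ih (N * w) r₁
    refine ⟨r, fun ι _ hι d hd φ hφ => ?_⟩
    choose m l e₀ ψ₀ e ψ hψ₀ hψ hwidth hdeg hsum using fun i => (hφ i).exists_sum
    have hcard : Fintype.card (Σ i, Σ j, Fin (l i j)) ≤ N * w := by
      simp only [Fintype.card_sigma, Fintype.card_fin]
      calc ∑ i, ∑ j, l i j ≤ ∑ _i : ι, w := Finset.sum_le_sum fun i _ =>
            (Finset.sum_le_sum fun j _ => Nat.le_succ _).trans (hwidth i)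
        _ = Fintype.card ι * w := by simp
        _ ≤ N * w := Nat.mul_le_mul_right w hι
    have hle : ∀ x : Σ i, Σ j, Fin (l i j), e x.1 x.2.1 x.2.2 ≤ D := fun x =>
      (Finset.single_le_sum (f := e x.1 x.2.1) (fun _ _ => Nat.zero_le _)
        (Finset.mem_univ x.2.2)).trans
          ((Nat.le_add_left _ _).trans ((hdeg x.1 x.2.1).trans (hd x.1)))
    obtain ⟨b₁, hb₁, hP⟩ := hr (Σ i, Σ j, Fin (l i j)) hcard (fun x => e x.1 x.2.1 x.2.2) hle
      (fun x => ψ x.1 x.2.1 x.2.2) fun x => hψ _ _ _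
    obtain ⟨b₂, hb₂, hF⟩ := hr₁ (Σ i, Σ j, Fin (l i j)) hcard _ hle _ hP
    choose Q hQ hfl using hF
    refine ⟨fun k => (b₂ k).biUnion b₁, hb₁.biUnion hb₂, fun i => ?_⟩
    simp only [hsum i, ← Finset.biUnion_biUnion]
    exact isPolyMapZero_sum_prod_floor (Q := fun j t => Q ⟨i, j, t⟩)
      (fun j => ((hψ₀ i j).comp_biUnion hb₁).comp_biUnion hb₂) (fun j t => hQ ⟨i, j, t⟩) (hdeg i)
      fun j t α hα => hfl ⟨i, j, t⟩ α hα

theorem mainTheorem6 (k : ℕ) (d : Fin k → ℕ) (h w s : ℕ) :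
    ∃ r : ℕ, ∀ φ : Fin k → Finset (Fin r) → ℝ,
      (∀ i, IsOpenGPolMap w h (d i) (φ i)) →
        ∃ B : Finset (Finset (Fin r)), IsDisjointSubcollection s B ∧
          ∀ i, IsPolyMapZero (d i) (restrictSubcollection B (φ i)) := by
  obtain ⟨r, hr⟩ := exists_disjointFamily_isPolyMapZero h w k (∑ i, d i) s
  refine ⟨r, fun φ hφ => ?_⟩
  obtain ⟨b, hb, hpoly⟩ := hr (Fin k) (by simp) d
    (fun i => Finset.single_le_sum (fun _ _ => Nat.zero_le _) (Finset.mem_univ i)) φ hφ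
  have hinj : Function.Injective b := fun i j hij => by
    by_contra hne
    have hd : Disjoint (b i) (b j) := hb.2 hne
    rw [← hij, Finset.disjoint_self_iff_empty] at hd
    exact (hb.1 i).ne_empty hd
  refine ⟨Finset.univ.image b, ⟨?_, ?_, ?_⟩, fun i => ?_⟩
  · simp [Finset.card_image_of_injective _ hinj]
  · simpa using hb.1
  · rintro _ hx _ hy hne
    simp only [Finset.coe_image, Finset.coe_univ, Set.image_univ, Set.mem_range] at hx hy
    obtain ⟨x, rfl⟩ := hx
    obtain ⟨y, rfl⟩ := hy
    exact hb.2 fun hxy => hne (congrArg b hxy)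
  -- Choosing an index for each block transfers polynomiality from `Fin s` to the subtype `B`.
  · have hmem : ∀ x : (Finset.univ.image b : Finset (Finset (Fin r))), ∃ j, b j = x := fun x => by
      obtain ⟨j, -, hj⟩ := Finset.mem_image.1 x.2
      exact ⟨j, hj⟩
    choose f hf using hmem
    have hfinj : Function.Injective f := fun x y hxy => by
      rw [Subtype.ext_iff, ← hf x, ← hf y, hxy]
    have h := (hpoly i).comp_biUnion (isDisjointFamily_singleton hfinj)
    simp only [Finset.biUnion_biUnion, Finset.singleton_biUnion, hf] at h
    exact h
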